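/- Let $n_a,n_b\ge 0$, $n\ge 1$, and consider on a probability space the switched ARX system $$y_k=\sum_{j=1}^{n_a}a_{j\delta_k}\,y_{k-j}+\sum_{j=1}^{n_b}b_{j\delta_k}\,u_{k-j}+\epsilon_k,\qquad k\ge 1,$$ with modes $\delta_k\in\{1,\dots,n\}$, a bounded deterministic input $(u_k)_{k\ge 1-n_b}$, and i.i.d. noise $(\epsilon_k)_{k\ge1}$ with $E|\epsilon_1|^{4n}<\infty$ and moments $m_d=E[\epsilon_1^d]$. For every $k\ge1$, $\epsilon_k$ is independent of the outputs $y_j$, $1-n_a\le j<k$ (initial conditions included), together with the modes $\delta_1,\dots,\delta_k$; the modes may be deterministic or random. Let $\mathbf r_k=(y_k-\epsilon_k,\,y_{k-1},\dots,y_{k-n_a},\,u_{k-1},\dots,u_{k-n_b})$, let $\nu_n$ be the Veronese map (all monomials of degree exactly $n$), and put $$\mathbf M_k^{\mathrm{proc}}=\nu_n(\mathbf r_k)\nu_n(\mathbf r_k)^\top,\qquad \mathcal M_N^{\mathrm{proc}}=\frac1N\sum_{k=1}^N\mathbf M_k^{\mathrm{proc}} .$$ Define polynomials by $P_h(x)=x^h-\sum_{d=1}^h\binom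 hd m_d\,P_{h-d}(x)$, $h\ge 0$. Let $\mathrm{mon}_{2n}$ be the vector of all monomials of degree at most $2n$, and let $M_{proc}$ be the affine map, with coefficients depending only on the moments $m_d$, such that $M_{proc}[\mathrm{mon}_{2n}(y_k,\dots,y_{k-n_a},u_{k-1},\dots,u_{k-n_b})]$ is obtained from $\mathbf M_k^{\mathrm{proc}}$ by replacing, in every entry, the factor $(y_k-\epsilon_k)^h$ by $P_h(y_k)$ and expanding into monomials. Let $$\widehat{\mathcal M}_N^{\mathrm{proc}}=\frac1N\sum_{k=1}^N M_{proc}[\mathrm{mon}_{2n}(y_k,\dots,y_{k-n_a},u_{k-1},\dots,u_{k-n_b})].$$ Suppose that for all integers $h_0,\dots,h_{n_a}\ge0$ with $\sum_i h_i\le 2n$ the monomials $z_k=y_k^{h_0}y_{k-1}^{h_1}\cdots y_{k-n_a}^{h_{n_a}}$, $k\ge1$, are square-integrable and satisfy $$\sum_{k=1}^\infty\frac{\mathrm{Var}(z_k)(\log k)^2}{k^2}<\infty,$$ and that there are constants $\rho_l$ ($l\ge1$) and $0\le q<1$ (possibly depending on the $h_i$) with $\sup_{k\ge1}|\mathrm{Cov}(z_k,z_{k+l})|\le\rho_l$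 for all $l\ge1$ and $\sum_{l=1}^\infty \rho_l/l^q<\infty$. Then all expectations below exist and, for every $k\ge1$, $$E[\mathbf M_k^{\mathrm{proc}}]=E\{M_{proc}[\mathrm{mon}_{2n}(y_k,\dots,u_{k-n_b})]\}=M_{proc}\{E[\mathrm{mon}_{2n}(y_k,\dots,u_{k-n_b})]\},$$ and, as $N\to\infty$, almost surely $$\widehat{\mathcal M}_N^{\mathrm{proc}}-\mathcal M_N^{\mathrm{proc}}\to0\qquad\text{and}\qquad \widehat{\mathcal M}_N^{\mathrm{proc}}-E[\mathcal M_N^{\mathrm{proc}}]\to0 .$$ -/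

import Mathlib

open MeasureTheory ProbabilityTheory Filter Topology

noncomputable section

namespace SARX

/-- Coordinates of the regressor: `inl i` is the output lagged by `i` (`0 ≤ i ≤ na`),
`inr j` is the input lagged by `j + 1` (`1 ≤ j + 1 ≤ nb`). -/
abbrev RegIdx (na nb : ℕ) : Type := Fin (na + 1) ⊕ Fin nb

/-- Exponents of the monomials of degree exactly `n` in the variables `ι`. -/
abbrev VeroneseIdx (ι : Type) [Fintype ι] (n : ℕ) : Type := {α : ι → ℕ // ∑ i, α i = n}

/-- Exponents of the monomials of degree at most `d` in the variables `ι`. -/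
abbrev MonIdx (ι : Type) [Fintype ι] (d : ℕ) : Type := {α : ι → ℕ // ∑ i, α i ≤ d}

/-- The Veronese map of degree `n`: all monomials of degree exactly `n`. -/
def veronese {ι : Type} [Fintype ι] (n : ℕ) (x : ι → ℝ) : VeroneseIdx ι n → ℝ :=
  fun α => ∏ i, x i ^ α.1 i

/-- All monomials of degree at most `d`. -/
def mon {ι : Type} [Fintype ι] (d : ℕ) (x : ι → ℝ) : MonIdx ι d → ℝ :=
  fun α => ∏ i, x i ^ α.1 i

/-- The measured data `(y_k, …, y_{k-na}, u_{k-1}, …, u_{k-nb})` of an output path `y`. -/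
def dataVec (na nb : ℕ) (y u : ℤ → ℝ) (k : ℤ) : RegIdx na nb → ℝ :=
  Sum.elim (fun i => y (k - (i : ℕ))) (fun j => u (k - ((j : ℕ) + 1)))

/-- The regressor `r_k = (y_k - ε_k, y_{k-1}, …, y_{k-na}, u_{k-1}, …, u_{k-nb})`. -/
def regressor (na nb : ℕ) (y ε u : ℤ → ℝ) (k : ℤ) : RegIdx na nb → ℝ :=
  Sum.elim (fun i => if i = 0 then y k - ε k else y (k - (i : ℕ)))
    (fun j => u (k - ((j : ℕ) + 1)))

/-- `M_k^proc = ν_n(r_k) ν_n(r_k)ᵀ`. -/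
def procMatrix (na nb n : ℕ) (y ε u : ℤ → ℝ) (k : ℤ) :
    Matrix (VeroneseIdx (RegIdx na nb) n) (VeroneseIdx (RegIdx na nb) n) ℝ :=
  Matrix.vecMulVec (veronese n (regressor na nb y ε u k)) (veronese n (regressor na nb y ε u k))

/-- `𝓜_N^proc = (1/N) ∑_{k=1}^N M_k^proc`. -/
def avgProcMatrix (na nb n : ℕ) (y ε u : ℤ → ℝ) (N : ℕ) :
    Matrix (VeroneseIdx (RegIdx na nb) n) (VeroneseIdx (RegIdx na nb) n) ℝ :=
  (N : ℝ)⁻¹ • ∑ k ∈ Finset.Icc 1 N, procMatrix na nb n y ε u (k : ℤ)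

/-- The polynomials `P_h` given by `P_h = X^h - ∑_{d=1}^h (h choose d) m_d P_{h-d}`; replacing
`(y_k - ε_k)^h` by `P_h(y_k)` removes the noise on average when `m_d` are the noise moments. -/
def debiasPoly (m : ℕ → ℝ) : ℕ → Polynomial ℝ
  | h => Polynomial.X ^ h -
      ∑ d : Fin h, Polynomial.C ((h.choose (d + 1) : ℝ) * m (d + 1)) * debiasPoly m (h - (d + 1))
termination_by h => h
decreasing_by have := d.2; omega

theorem sum_update_le {ι : Type} [Fintype ι] [DecidableEq ι] {n : ℕ}
    (α β : VeroneseIdx ι n) (c : ι) (i : Fin ((α.1 + β.1) c + 1)) :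
    ∑ j, Function.update (α.1 + β.1) c (i : ℕ) j ≤ 2 * n := by
  have h : ∑ j, Function.update (α.1 + β.1) c (i : ℕ) j ≤ ∑ j, (α.1 + β.1) j := by
    refine Finset.sum_le_sum fun j _ => ?_
    by_cases hj : j = c
    · subst hj
      simpa using Nat.lt_succ_iff.mp i.2
    · simp [hj]
  refine h.trans (le_of_eq ?_)
  simp only [Pi.add_apply, Finset.sum_add_distrib, α.2, β.2]
  ring

/-- The affine map `M_proc`, determined by the noise moments `m`. The entry of `M_k^proc` at
`(α, β)` is a monomial with exponents `α + β`, in which the current output occurs as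
`(y_k - ε_k)^h`, `h = (α + β)_0`. The map takes a vector `v`, indexed by the monomials of degree
at most `2 n` of the measured data, to the matrix whose entry at `(α, β)` is obtained by replacing
`(y_k - ε_k)^h` by `P_h(y_k)`, expanding, and reading off the resulting monomials from `v`. -/
def Mproc (na nb n : ℕ) (m : ℕ → ℝ) :
    (MonIdx (RegIdx na nb) (2 * n) → ℝ) →ᵃ[ℝ]
      Matrix (VeroneseIdx (RegIdx na nb) n) (VeroneseIdx (RegIdx na nb) n) ℝ :=
  LinearMap.toAffineMap
    { toFun := fun v => Matrix.of fun α β =>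
        ∑ i : Fin ((α.1 + β.1) (Sum.inl 0) + 1),
          (debiasPoly m ((α.1 + β.1) (Sum.inl 0))).coeff i *
            v ⟨Function.update (α.1 + β.1) (Sum.inl 0) (i : ℕ),
              sum_update_le α β (Sum.inl 0) i⟩
      map_add' := fun v w => by
        ext α β
        simp [mul_add, Finset.sum_add_distrib]
      map_smul' := fun c v => by
        ext α β
        simp only [Matrix.of_apply, Matrix.smul_apply, Pi.smul_apply, smul_eq_mul,
          RingHom.id_apply, Finset.mul_sum]
        exact Finset.sum_congr rfl fun i _ => by ring }

/-- `(1/N) ∑_{k=1}^N M_proc[mon(y_k, …, y_{k-na}, u_{k-1}, …, u_{k-nb})]`. -/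
def empMatrix (na nb n : ℕ) (m : ℕ → ℝ) (y u : ℤ → ℝ) (N : ℕ) :
    Matrix (VeroneseIdx (RegIdx na nb) n) (VeroneseIdx (RegIdx na nb) n) ℝ :=
  (N : ℝ)⁻¹ • ∑ k ∈ Finset.Icc 1 N,
    Mproc na nb n m (mon (2 * n) (dataVec na nb y u (k : ℤ)))

/-- The path of a process `x` at the sample point `ω`. -/
def path {Ω : Type*} (x : ℤ → Ω → ℝ) (ω : Ω) : ℤ → ℝ := fun j => x j ω

/-- The moments `m_d = E[ε_1^d]` of identically distributed noise. -/
def noiseMoment {Ω : Type*} [MeasurableSpace Ω] (P : Measure Ω) (ε : ℤ → Ω → ℝ) (d : ℕ) : ℝ :=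
  ∫ ω, ε 1 ω ^ d ∂P

/-- The output monomial `z_k = y_k^{h_0} y_{k-1}^{h_1} ⋯ y_{k-na}^{h_na}`. -/
def outMon {na : ℕ} (h : Fin (na + 1) → ℕ) (y : ℤ → ℝ) (k : ℤ) : ℝ :=
  ∏ i : Fin (na + 1), y (k - (i : ℕ)) ^ h i

/-- A switched ARX process with i.i.d. process noise and bounded deterministic input `u`.
`a j i`, `b j i` are the coefficients of mode `i` at lag `j + 1`; `δ k` is the mode active at time
`k ≥ 1`; the outputs `y_{1-na}, …, y_0` are initial conditions. -/
structure IsSARX {Ω : Type*} [MeasurableSpace Ω] (P : Measure Ω) {na nb n : ℕ}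
    (a : Fin na → Fin n → ℝ) (b : Fin nb → Fin n → ℝ)
    (δ : ℤ → Ω → Fin n) (u : ℤ → ℝ) (y ε : ℤ → Ω → ℝ) : Prop where
  measurable_noise : ∀ k : ℤ, 1 ≤ k → Measurable (ε k)
  measurable_mode : ∀ k : ℤ, 1 ≤ k → Measurable (δ k)
  measurable_output : ∀ k : ℤ, 1 - (na : ℤ) ≤ k → Measurable (y k)
  dynamics : ∀ k : ℤ, 1 ≤ k → ∀ ω, y k ω =
    ∑ j : Fin na, a j (δ k ω) * y (k - ((j : ℕ) + 1)) ω +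
      ∑ j : Fin nb, b j (δ k ω) * u (k - ((j : ℕ) + 1)) + ε k ω
  noise_indep : iIndepFun (fun k : Set.Ici (1 : ℤ) => ε k) P
  noise_identDistrib : ∀ k : ℤ, 1 ≤ k → IdentDistrib (ε k) (ε 1) P P
  /-- The noise at time `k` is independent of the outputs before time `k` (initial conditions
  included) and of the modes up to time `k`. For deterministic switching this says that the noise
  is independent of the initial conditions. -/
  noise_indep_past : ∀ k : ℤ, 1 ≤ k → IndepFun (ε k)
    (fun ω => ((fun j : Set.Ico (1 - (na : ℤ)) k => y j ω),
      (fun j : Set.Icc (1 : ℤ) k => δ j ω))) P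
  noise_moments : MemLp (ε 1) ((4 * n : ℕ) : ENNReal) P
  input_bounded : ∃ L : ℝ, ∀ k : ℤ, 1 - (nb : ℤ) ≤ k → |u k| ≤ L

end SARX

end

open SARX

namespace SARX

/-! Fix an entry of the matrix, and let h be the exponent of the current output in it. By the
dynamics, x = y_k - ε_k is a function of the past (outputs before k, modes up to k), while ε_k is
independent of that past. Expanding (x + ε_k)^j binomially turns the recursion for P_h into E[G
P_h(x + ε_k)] = E[G x^h] for past-measurable G with the required integrability
(`integral_mul_debiasPoly`). Taking for G the lagged factor of the entry gives unbiasedness.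

With a further square-integrable past factor Q in G, the same identity makes the error of the
substitution orthogonal to the past (`integral_mul_debiasError`). Since earlier errors belong to the
past, the errors are centred and pairwise uncorrelated. The error at time k is also uncorrelated
with the true entry, so its variance is at most that of the debiased entry, a finite combination of
the given monomials. The first limit is thus a strong law with zero covariance bound. For the
second, the strong law is applied to each monomial of the data, and finitely many limits are
combined linearly.

The strong law `strong_law_of_covariance_le` rests on the Rademacher–Menshov method: partial sums in
a dyadic block are controlled by a dyadic energy, whose normalised expectations are summable over
the blocks under the variance and covariance conditions. -/

/-! ### Rademacher–Menshov inequality and averages over dyadic blocks. -/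

/-- The sum of the squares of the sums of `f` over all dyadic subintervals of
`[a, a + 2 ^ p)`. -/
noncomputable def dyadicEnergy (f : ℕ → ℝ) : ℕ → ℕ → ℝ
  | 0, a => f a ^ 2
  | p + 1, a => dyadicEnergy f p a + dyadicEnergy f p (a + 2 ^ p) +
      (∑ k ∈ Finset.range (2 ^ (p + 1)), f (a + k)) ^ 2

theorem dyadicEnergy_nonneg (f : ℕ → ℝ) (p a : ℕ) : 0 ≤ dyadicEnergy f p a := by
  induction p generalizing a with
  | zero => simp only [dyadicEnergy]; positivity
  | succ p ih => simp only [dyadicEnergy]; have := ih a; have := ih (a + 2 ^ p); positivity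

theorem sq_sum_block_le_dyadicEnergy (f : ℕ → ℝ) (p a : ℕ) :
    (∑ k ∈ Finset.range (2 ^ p), f (a + k)) ^ 2 ≤ dyadicEnergy f p a := by
  cases p with
  | zero => simp [dyadicEnergy]
  | succ p =>
    simp only [dyadicEnergy]
    have := dyadicEnergy_nonneg f p a
    have := dyadicEnergy_nonneg f p (a + 2 ^ p)
    linarith

/-- The pointwise Rademacher–Menshov inequality. -/
theorem sq_sum_range_le_dyadicEnergy (f : ℕ → ℝ) (p a m : ℕ) (hm : m ≤ 2 ^ p) :
    (∑ k ∈ Finset.range m, f (a + k)) ^ 2 ≤ (p + 1) * dyadicEnergy f p a := by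
  induction p generalizing a m with
  | zero =>
    have hm' : m = 0 ∨ m = 1 := by simp at hm; omega
    rcases hm' with rfl | rfl
    · simpa using dyadicEnergy_nonneg f 0 a
    · simp [dyadicEnergy]
  | succ p ih =>
    have h1 := dyadicEnergy_nonneg f p a
    have h2 := dyadicEnergy_nonneg f p (a + 2 ^ p)
    have h3 := sq_nonneg (∑ k ∈ Finset.range (2 ^ (p + 1)), f (a + k))
    have hp : (0 : ℝ) ≤ p := p.cast_nonneg
    simp only [dyadicEnergy]
    push_cast
    rcases le_total m (2 ^ p) with h | h
    · refine (ih a m h).trans ?_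
      gcongr <;> linarith
    · obtain ⟨r, rfl⟩ := Nat.exists_eq_add_of_le h
      have hr : r ≤ 2 ^ p := by rw [pow_succ] at hm; omega
      have hR := ih (a + 2 ^ p) r hr
      have hT := sq_sum_block_le_dyadicEnergy f p a
      rw [Finset.sum_range_add]
      simp only [← add_assoc]
      set T := ∑ k ∈ Finset.range (2 ^ p), f (a + k)
      set R := ∑ k ∈ Finset.range r, f (a + 2 ^ p + k)
      -- Weighted Cauchy–Schwarz, with weights chosen so that the bounds 1 for the full left half
      -- and p + 1 for the partial right half both become p + 2.
      have key : (T + R) ^ 2 * (p + 1) ≤ (p + 2) * ((p + 1) * T ^ 2 + R ^ 2) := by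
        nlinarith [sq_nonneg ((p + 1) * T - R)]
      have : (T + R) ^ 2 * (p + 1) ≤
          ((p + 2) * (dyadicEnergy f p a + dyadicEnergy f p (a + 2 ^ p))) * (p + 1) := by
        refine key.trans ?_
        nlinarith [mul_le_mul_of_nonneg_left hT (by positivity : (0 : ℝ) ≤ (p + 2) * (p + 1)),
          mul_le_mul_of_nonneg_left hR (by positivity : (0 : ℝ) ≤ (p + 2))]
      have := le_of_mul_le_mul_right this (by positivity)
      nlinarith

theorem tendsto_zero_of_le_half_add {a e : ℕ → ℝ} (ha : ∀ p, 0 ≤ a p)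
    (h : ∀ p, a (p + 1) ≤ a p / 2 + e p) (he : Tendsto e atTop (𝓝 0)) :
    Tendsto a atTop (𝓝 0) := by
  rw [Metric.tendsto_atTop]
  intro ε hε
  obtain ⟨p₀, hp₀⟩ := (Metric.tendsto_atTop.1 he) (ε / 4) (by positivity)
  -- ε / 2 is the fixed point of s ↦ s / 2 + ε / 4, so the errors never accumulate beyond it.
  have key : ∀ j, a (p₀ + j) ≤ a p₀ * (1 / 2) ^ j + ε / 2 := by
    intro j
    induction j with
    | zero => simp; positivity
    | succ j ih =>
      have h1 := h (p₀ + j)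
      have h2 := hp₀ (p₀ + j) (by omega)
      rw [Real.dist_0_eq_abs] at h2
      have h3 := (abs_lt.1 h2).2
      rw [pow_succ, ← add_assoc]
      nlinarith
  have ht : Tendsto (fun j : ℕ => a p₀ * (1 / 2 : ℝ) ^ j) atTop (𝓝 0) := by
    simpa using (tendsto_pow_atTop_nhds_zero_of_lt_one (r := (1 / 2 : ℝ))
      (by norm_num) (by norm_num)).const_mul (a p₀)
  obtain ⟨j₀, hj₀⟩ := (Metric.tendsto_atTop.1 ht) (ε / 2) (by positivity)
  refine ⟨p₀ + j₀, fun p hp => ?_⟩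
  obtain ⟨j, rfl⟩ := Nat.exists_eq_add_of_le (show p₀ ≤ p by omega)
  have h1 := hj₀ j (by omega)
  rw [Real.dist_0_eq_abs] at h1 ⊢
  rw [abs_of_nonneg (ha _)]
  have := (abs_lt.1 h1).2
  linarith [key j]

/-- Averages tend to zero if the maximal partial sums over the dyadic blocks `[2 ^ p, 2 ^ (p + 1))`
are `o(2 ^ p)`, in the form controlled by the dyadic energy. -/
theorem tendsto_average_of_dyadicEnergy (f : ℕ → ℝ)
    (h : Tendsto (fun p : ℕ => ((p : ℝ) + 1) * dyadicEnergy f p (2 ^ p) / 4 ^ p) atTop (𝓝 0)) :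
    Tendsto (fun N : ℕ => (N : ℝ)⁻¹ * ∑ k ∈ Finset.Icc 1 N, f k) atTop (𝓝 0) := by
  set e : ℕ → ℝ := fun p => √(((p : ℝ) + 1) * dyadicEnergy f p (2 ^ p) / 4 ^ p) with he
  have het : Tendsto e atTop (𝓝 0) := by
    simpa [he] using h.sqrt
  set S : ℕ → ℝ := fun N => ∑ k ∈ Finset.Ico 1 N, f k with hS
  have hblock : ∀ p m : ℕ, m ≤ 2 ^ p → |S (2 ^ p + m) - S (2 ^ p)| ≤ 2 ^ p * e p := by
    intro p m hm
    have h1 : S (2 ^ p + m) - S (2 ^ p) = ∑ k ∈ Finset.range m, f (2 ^ p + k) := by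
      simp only [hS]
      rw [← Finset.sum_Ico_consecutive f (Nat.one_le_two_pow (n := p)) (Nat.le_add_right _ m),
        add_sub_cancel_left, Finset.sum_Ico_eq_sum_range]
      simp
    rw [h1]
    refine abs_le_of_sq_le_sq ?_ (by positivity)
    rw [mul_pow, he, Real.sq_sqrt (by have := dyadicEnergy_nonneg f p (2 ^ p); positivity)]
    refine (sq_sum_range_le_dyadicEnergy f p (2 ^ p) m hm).trans (le_of_eq ?_)
    rw [← pow_mul, mul_comm p 2, pow_mul]
    norm_num
    field_simp
  have ha : Tendsto (fun p : ℕ => |S (2 ^ p)| / 2 ^ p) atTop (𝓝 0) := by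
    refine tendsto_zero_of_le_half_add (e := e) (fun p => by positivity) (fun p => ?_) het
    have h1 := hblock p (2 ^ p) le_rfl
    have h2 : (2 : ℕ) ^ (p + 1) = 2 ^ p + 2 ^ p := by ring
    have h3 : |S (2 ^ (p + 1))| ≤ |S (2 ^ p)| + 2 ^ p * e p := by
      rw [h2]
      have := abs_sub_abs_le_abs_sub (S (2 ^ p + 2 ^ p)) (S (2 ^ p))
      linarith
    have h4 : 0 ≤ e p := Real.sqrt_nonneg _
    rw [div_le_iff₀ (by positivity), pow_succ]
    have h5 : (0 : ℝ) < 2 ^ p := by positivity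
    calc _ ≤ _ := h3
      _ ≤ |S (2 ^ p)| + 2 * (2 ^ p * e p) := by nlinarith
      _ = _ := by field_simp; ring
  have hlog : Tendsto (fun N : ℕ => Nat.log 2 (N + 1)) atTop atTop := by
    refine tendsto_atTop.2 fun b => ?_
    filter_upwards [eventually_ge_atTop (2 ^ b)] with N hN
    exact Nat.le_log_of_pow_le (by norm_num) (by omega)
  have hsum := (ha.add het).comp hlog
  rw [add_zero] at hsum
  have hsum2 := hsum.const_mul 2
  rw [mul_zero] at hsum2
  refine squeeze_zero_norm' ?_ hsum2
  filter_upwards [eventually_ge_atTop 1] with N hN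
  -- `S` sums over `Ico 1 N`, so the average up to N involves `S (N + 1)`; hence the logarithm of N
  -- + 1.
  set p := Nat.log 2 (N + 1) with hp
  have h1 : 2 ^ p ≤ N + 1 := Nat.pow_log_le_self 2 (by omega)
  have h2 : N + 1 < 2 ^ (p + 1) := Nat.lt_pow_succ_log_self (by norm_num) _
  obtain ⟨m, hm⟩ := Nat.exists_eq_add_of_le h1
  have hm' : m ≤ 2 ^ p := by rw [pow_succ] at h2; omega
  have h3 := hblock p m hm'
  rw [← hm] at h3
  have h4 : ∑ k ∈ Finset.Icc 1 N, f k = S (N + 1) := rfl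
  rw [h4, norm_mul, norm_inv, Real.norm_natCast, Real.norm_eq_abs]
  have h5 : |S (N + 1)| ≤ |S (2 ^ p)| + 2 ^ p * e p := by
    have := abs_sub_abs_le_abs_sub (S (N + 1)) (S (2 ^ p))
    linarith
  have h6 : (2 : ℝ) ^ p ≤ 2 * N := by
    have : 2 ^ p ≤ 2 * N := by omega
    exact_mod_cast this
  have hN' : (0 : ℝ) < N := by exact_mod_cast hN
  have h7 : (N : ℝ)⁻¹ ≤ 2 * (2 ^ p)⁻¹ := by
    rw [inv_le_comm₀ hN' (by positivity), mul_inv, inv_inv]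
    linarith
  have h8 : 0 ≤ e p := Real.sqrt_nonneg _
  calc (N : ℝ)⁻¹ * |S (N + 1)| ≤ 2 * (2 ^ p)⁻¹ * (|S (2 ^ p)| + 2 ^ p * e p) := by gcongr
    _ = 2 * (|S (2 ^ p)| / 2 ^ p + e p) := by field_simp

/-! ### Second moments of dyadic blocks and the strong law. -/

theorem ae_summable_of_summable_integral {Ω : Type*} [MeasurableSpace Ω] {P : Measure Ω}
    {F : ℕ → Ω → ℝ} (hint : ∀ p, Integrable (F p) P) (hnn : ∀ p ω, 0 ≤ F p ω)
    (hs : Summable fun p => ∫ ω, F p ω ∂P) : ∀ᵐ ω ∂P, Summable fun p => F p ω := by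
  have h := summable_norm_of_tsum_eLpNorm_ne_top (μ := P) (p := 1) le_rfl
    (fun p => (hint p).aestronglyMeasurable) (by
      have : ∀ p, eLpNorm (F p) 1 P = ENNReal.ofReal (∫ ω, F p ω ∂P) := by
        intro p
        rw [eLpNorm_one_eq_lintegral_enorm, ofReal_integral_eq_lintegral_ofReal (hint p)
          (Eventually.of_forall (hnn p))]
        refine lintegral_congr fun ω => ?_
        rw [Real.enorm_eq_ofReal (hnn p ω)]
      simp_rw [this]
      exact hs.tsum_ofReal_ne_top)
  filter_upwards [h] with ω hω
  simpa [Real.norm_eq_abs, abs_of_nonneg (hnn _ _)] using hω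

section Energy

variable {Ω : Type*} [MeasurableSpace Ω] {P : Measure Ω} {Y : ℕ → Ω → ℝ}

theorem integrable_dyadicEnergy (hY : ∀ k, 1 ≤ k → MemLp (Y k) 2 P) (p a : ℕ) (ha : 1 ≤ a) :
    Integrable (fun ω => dyadicEnergy (fun k => Y k ω) p a) P := by
  induction p generalizing a with
  | zero => exact (hY a ha).integrable_sq
  | succ p ih =>
    refine ((ih a ha).add (ih (a + 2 ^ p) (Nat.le_add_right_of_le ha))).add ?_
    exact (memLp_finsetSum _ fun k _ => hY (a + k) (by omega)).integrable_sq

/-- Induction on the length: a new last term meets each earlier term at a distinct lag, so every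
step adds at most twice the sum of the ρ l. -/
theorem integral_sq_sum_range_le (hY : ∀ k, 1 ≤ k → MemLp (Y k) 2 P) {ρ : ℕ → ℝ}
    (hcov : ∀ l k : ℕ, 1 ≤ l → 1 ≤ k → |∫ ω, Y k ω * Y (k + l) ω ∂P| ≤ ρ l)
    (a m : ℕ) (ha : 1 ≤ a) :
    ∫ ω, (∑ k ∈ Finset.range m, Y (a + k) ω) ^ 2 ∂P ≤
      ∑ k ∈ Finset.range m, ∫ ω, Y (a + k) ω ^ 2 ∂P + 2 * m * ∑ l ∈ Finset.Ico 1 m, ρ l := by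
  induction m with
  | zero => simp
  | succ m ih =>
    have hρ : ∀ l, 1 ≤ l → 0 ≤ ρ l := fun l hl => (abs_nonneg _).trans (hcov l 1 hl le_rfl)
    have hS : MemLp (fun ω => ∑ k ∈ Finset.range m, Y (a + k) ω) 2 P :=
      memLp_finsetSum _ fun k _ => hY (a + k) (by omega)
    have hm := hY (a + m) (by omega)
    have hexp : ∫ ω, (∑ k ∈ Finset.range (m + 1), Y (a + k) ω) ^ 2 ∂P =
        ∫ ω, (∑ k ∈ Finset.range m, Y (a + k) ω) ^ 2 ∂P +
          2 * ∑ k ∈ Finset.range m, ∫ ω, Y (a + k) ω * Y (a + m) ω ∂P +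
          ∫ ω, Y (a + m) ω ^ 2 ∂P := by
      have hint : ∀ k ∈ Finset.range m, Integrable (fun ω => Y (a + k) ω * Y (a + m) ω) P :=
        fun k _ => (hY (a + k) (by omega)).integrable_mul hm
      rw [← integral_finsetSum _ hint, ← integral_const_mul, ← integral_add, ← integral_add]
      · refine integral_congr_ae (Eventually.of_forall fun ω => ?_)
        simp only [Finset.sum_range_succ, ← Finset.sum_mul]
        ring
      · exact hS.integrable_sq.add ((integrable_finsetSum _ hint).const_mul 2)
      · exact hm.integrable_sq
      · exact hS.integrable_sq
      · exact (integrable_finsetSum _ hint).const_mul 2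
    have hcross : ∑ k ∈ Finset.range m, ∫ ω, Y (a + k) ω * Y (a + m) ω ∂P ≤
        ∑ l ∈ Finset.Ico 1 (m + 1), ρ l := by
      have h1 : ∑ l ∈ Finset.Ico 1 (m + 1), ρ l = ∑ k ∈ Finset.range m, ρ (m - k) := by
        rw [Finset.sum_Ico_eq_sum_range, ← Finset.sum_range_reflect]
        refine Finset.sum_congr rfl fun k hk => ?_
        have := Finset.mem_range.1 hk
        congr 1
        omega
      rw [h1]
      refine Finset.sum_le_sum fun k hk => ?_
      have hk' := Finset.mem_range.1 hk
      have := hcov (m - k) (a + k) (by omega) (by omega)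
      rw [show a + k + (m - k) = a + m by omega] at this
      exact (le_abs_self _).trans this
    have hmono : ∑ l ∈ Finset.Ico 1 m, ρ l ≤ ∑ l ∈ Finset.Ico 1 (m + 1), ρ l :=
      Finset.sum_le_sum_of_subset_of_nonneg (Finset.Ico_subset_Ico_right (by omega))
        fun l hl _ => hρ l (Finset.mem_Ico.1 hl).1
    rw [hexp, Finset.sum_range_succ]
    push_cast
    have : 2 * (m : ℝ) * ∑ l ∈ Finset.Ico 1 m, ρ l ≤
        2 * (m : ℝ) * ∑ l ∈ Finset.Ico 1 (m + 1), ρ l := by gcongr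
    linarith

/-- Each of the p + 1 dyadic levels partitions the block. One level contributes all second moments
once, and its cross terms add up to at most the total length times twice the sum of the ρ l. -/
theorem integral_dyadicEnergy_le (hY : ∀ k, 1 ≤ k → MemLp (Y k) 2 P) {ρ : ℕ → ℝ}
    (hcov : ∀ l k : ℕ, 1 ≤ l → 1 ≤ k → |∫ ω, Y k ω * Y (k + l) ω ∂P| ≤ ρ l)
    (p a : ℕ) (ha : 1 ≤ a) :
    ∫ ω, dyadicEnergy (fun k => Y k ω) p a ∂P ≤
      (p + 1) * (∑ k ∈ Finset.range (2 ^ p), ∫ ω, Y (a + k) ω ^ 2 ∂P +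
        2 * 2 ^ p * ∑ l ∈ Finset.Ico 1 (2 ^ p), ρ l) := by
  induction p generalizing a with
  | zero => simp [dyadicEnergy]
  | succ p ih =>
    have hρ : ∀ l, 1 ≤ l → 0 ≤ ρ l := fun l hl => (abs_nonneg _).trans (hcov l 1 hl le_rfl)
    have h1 := ih a ha
    have h2 := ih (a + 2 ^ p) (Nat.le_add_right_of_le ha)
    have h3 := integral_sq_sum_range_le hY hcov a (2 ^ (p + 1)) ha
    have i1 := integrable_dyadicEnergy hY p a ha
    have i2 := integrable_dyadicEnergy hY p (a + 2 ^ p) (Nat.le_add_right_of_le ha)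
    have i3 : Integrable (fun ω => (∑ k ∈ Finset.range (2 ^ (p + 1)), Y (a + k) ω) ^ 2) P :=
      (memLp_finsetSum _ fun k _ => hY (a + k) (by omega)).integrable_sq
    simp only [dyadicEnergy]
    have i12 : Integrable (fun ω => dyadicEnergy (fun k => Y k ω) p a +
        dyadicEnergy (fun k => Y k ω) p (a + 2 ^ p)) P := i1.add i2
    rw [integral_add i12 i3, integral_add i1 i2]
    have hsplit : ∑ k ∈ Finset.range (2 ^ (p + 1)), ∫ ω, Y (a + k) ω ^ 2 ∂P =
        ∑ k ∈ Finset.range (2 ^ p), ∫ ω, Y (a + k) ω ^ 2 ∂P +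
          ∑ k ∈ Finset.range (2 ^ p), ∫ ω, Y (a + 2 ^ p + k) ω ^ 2 ∂P := by
      rw [pow_succ, mul_two, Finset.sum_range_add]
      simp only [add_assoc]
    have hmono : ∑ l ∈ Finset.Ico 1 (2 ^ p), ρ l ≤ ∑ l ∈ Finset.Ico 1 (2 ^ (p + 1)), ρ l :=
      Finset.sum_le_sum_of_subset_of_nonneg
        (Finset.Ico_subset_Ico_right (Nat.pow_le_pow_right (by norm_num) (by omega)))
        fun l hl _ => hρ l (Finset.mem_Ico.1 hl).1
    rw [hsplit] at h3 ⊢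
    set V1 := ∑ k ∈ Finset.range (2 ^ p), ∫ ω, Y (a + k) ω ^ 2 ∂P
    set V2 := ∑ k ∈ Finset.range (2 ^ p), ∫ ω, Y (a + 2 ^ p + k) ω ^ 2 ∂P
    set R := ∑ l ∈ Finset.Ico 1 (2 ^ p), ρ l
    set R' := ∑ l ∈ Finset.Ico 1 (2 ^ (p + 1)), ρ l
    have h4 : (p + 1 : ℝ) * (2 * 2 ^ p * R) ≤ (p + 1 : ℝ) * (2 * 2 ^ p * R') := by gcongr
    push_cast at h3 ⊢
    rw [pow_succ (2 : ℝ)] at h3 ⊢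
    linarith

end Energy

/-- On the block [2^p, 2^(p+1)) the weight log² k / k² is comparable to (p + 1)² / 4^p once p ≥ 1.
-/
theorem summable_log_block {v : ℕ → ℝ} (hv : ∀ k, 0 ≤ v k)
    (hs : Summable fun k : ℕ => v k * Real.log k ^ 2 / (k : ℝ) ^ 2) :
    Summable fun p : ℕ => ((p : ℝ) + 1) ^ 2 / 4 ^ p *
      ∑ k ∈ Finset.range (2 ^ p), v (2 ^ p + k) := by
  set g : ℕ → ℝ := fun k => v k * Real.log k ^ 2 / (k : ℝ) ^ 2 with hg
  have hgnn : ∀ k, 0 ≤ g k := fun k => by have := hv k; simp only [hg]; positivity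
  have hblock : Summable fun p : ℕ => ∑ k ∈ Finset.range (2 ^ p), g (2 ^ p + k) := by
    refine summable_of_sum_range_le (c := ∑' k, g k)
      (fun p => Finset.sum_nonneg fun k _ => hgnn _) fun M => ?_
    have : ∑ p ∈ Finset.range M, ∑ k ∈ Finset.range (2 ^ p), g (2 ^ p + k) =
        ∑ k ∈ Finset.Ico 1 (2 ^ M), g k := by
      induction M with
      | zero => simp
      | succ M ih =>
        rw [Finset.sum_range_succ, ih, ← Finset.sum_Ico_consecutive g
          (Nat.one_le_two_pow (n := M)) (Nat.pow_le_pow_right (by norm_num) (Nat.le_succ M)),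
          Finset.sum_Ico_eq_sum_range _ (2 ^ M), pow_succ, mul_two, Nat.add_sub_cancel]
    rw [this]
    exact hs.sum_le_tsum _ fun k _ => hgnn k
  -- The block p = 0 is dropped because log 1 = 0 gives no control there.
  rw [← summable_nat_add_iff 1]
  refine Summable.of_nonneg_of_le (fun p => ?_) (fun p => ?_)
    (((summable_nat_add_iff 1).2 hblock).mul_left (16 / Real.log 2 ^ 2))
  · exact mul_nonneg (by positivity) (Finset.sum_nonneg fun k _ => hv _)
  · rw [Finset.mul_sum, Finset.mul_sum]
    refine Finset.sum_le_sum fun k hk => ?_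
    have hk' := Finset.mem_range.1 hk
    set j := 2 ^ (p + 1) + k with hj
    have hlog2 : 0 < Real.log 2 := Real.log_pos (by norm_num)
    have hj1 : (2 : ℝ) ^ (p + 1) ≤ j := by
      have : 2 ^ (p + 1) ≤ j := by omega
      exact_mod_cast this
    have hj2 : (j : ℝ) ≤ 2 * 2 ^ (p + 1) := by
      have : j ≤ 2 * 2 ^ (p + 1) := by omega
      exact_mod_cast this
    have hjpos : (0 : ℝ) < j := lt_of_lt_of_le (by positivity) hj1
    have hlog : ((p + 1 : ℕ) : ℝ) * Real.log 2 ≤ Real.log j := by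
      rw [← Real.log_pow]
      exact Real.log_le_log (by positivity) hj1
    have hsq : (j : ℝ) ^ 2 ≤ 4 * 4 ^ (p + 1) := by
      have : (4 : ℝ) ^ (p + 1) = (2 ^ (p + 1)) ^ 2 := by
        rw [← pow_mul, mul_comm, pow_mul]; norm_num
      rw [this]
      nlinarith
    have hlogsq : (((p + 1 : ℕ) : ℝ) + 1) ^ 2 * Real.log 2 ^ 2 ≤ 4 * Real.log j ^ 2 := by
      have hp : (((p + 1 : ℕ) : ℝ) + 1) * Real.log 2 ≤ 2 * Real.log j := by
        push_cast at hlog ⊢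
        nlinarith [p.cast_nonneg (α := ℝ)]
      have h0 : 0 ≤ (((p + 1 : ℕ) : ℝ) + 1) * Real.log 2 := by positivity
      nlinarith
    have hvj := hv j
    simp only [hg]
    have hcoef : (((p + 1 : ℕ) : ℝ) + 1) ^ 2 / 4 ^ (p + 1) ≤
        16 / Real.log 2 ^ 2 * (Real.log j ^ 2 / (j : ℝ) ^ 2) := by
      rw [div_mul_div_comm, div_le_div_iff₀ (by positivity) (by positivity)]
      calc _ = ((((p + 1 : ℕ) : ℝ) + 1) ^ 2 * Real.log 2 ^ 2) * (j : ℝ) ^ 2 := by ring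
        _ ≤ (4 * Real.log j ^ 2) * (4 * 4 ^ (p + 1)) := by gcongr
        _ = _ := by ring
    calc _ ≤ 16 / Real.log 2 ^ 2 * (Real.log j ^ 2 / (j : ℝ) ^ 2) * v j := by gcongr
      _ = _ := by ring

theorem summable_sq_mul_geometric {r : ℝ} (hr0 : 0 ≤ r) (hr : r < 1) :
    Summable fun p : ℕ => ((p : ℝ) + 1) ^ 2 * r ^ p := by
  have h2 := summable_pow_mul_geometric_of_norm_lt_one 2 (r := r)
    (by rwa [Real.norm_of_nonneg hr0])
  have h1 := summable_pow_mul_geometric_of_norm_lt_one 1 (r := r)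
    (by rwa [Real.norm_of_nonneg hr0])
  have h0 := summable_geometric_of_lt_one hr0 hr
  refine ((h2.add (h1.mul_left 2)).add h0).congr fun p => ?_
  ring

/-- For l < 2^p one has l^q ≤ 2^(qp), so the covariance sum grows at most like 2^(qp); since q < 1,
the series is dominated by (p + 1)² (2^q / 2)^p. -/
theorem summable_covariance_block {ρ : ℕ → ℝ} {q : ℝ} (hq0 : 0 ≤ q) (hq1 : q < 1)
    (hρ : ∀ l, 1 ≤ l → 0 ≤ ρ l) (hs : Summable fun l : ℕ => ρ l / (l : ℝ) ^ q) :
    Summable fun p : ℕ => ((p : ℝ) + 1) ^ 2 / 4 ^ p *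
      (2 * 2 ^ p * ∑ l ∈ Finset.Ico 1 (2 ^ p), ρ l) := by
  have hs1 := (summable_nat_add_iff 1).2 hs
  -- The index is shifted because ρ 0 is unconstrained and may be negative.
  set C := ∑' l : ℕ, ρ (l + 1) / ((l + 1 : ℕ) : ℝ) ^ q with hC
  have hbound : ∀ p : ℕ, ∑ l ∈ Finset.Ico 1 (2 ^ p), ρ l ≤ ((2 : ℝ) ^ q) ^ p * C := by
    intro p
    have h1 : ∑ l ∈ Finset.Ico 1 (2 ^ p), ρ l / (l : ℝ) ^ q ≤ C := by
      rw [Finset.sum_Ico_eq_sum_range]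
      simp only [add_comm 1]
      refine hs1.sum_le_tsum _ fun l _ => div_nonneg (hρ _ (by omega)) (by positivity)
    calc _ ≤ ∑ l ∈ Finset.Ico 1 (2 ^ p), ((2 : ℝ) ^ q) ^ p * (ρ l / (l : ℝ) ^ q) := by
          refine Finset.sum_le_sum fun l hl => ?_
          obtain ⟨hl1, hl2⟩ := Finset.mem_Ico.1 hl
          have hlpos : (0 : ℝ) < l := by exact_mod_cast hl1
          have hl3 : (l : ℝ) ^ q ≤ ((2 : ℝ) ^ q) ^ p := by
            rw [← Real.rpow_natCast, ← Real.rpow_mul (by norm_num), mul_comm, Real.rpow_mul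
              (by norm_num), Real.rpow_natCast]
            exact Real.rpow_le_rpow hlpos.le (by exact_mod_cast hl2.le) hq0
          have hpos : 0 < (l : ℝ) ^ q := Real.rpow_pos_of_pos hlpos q
          calc ρ l = (l : ℝ) ^ q * (ρ l / (l : ℝ) ^ q) := by field_simp
            _ ≤ _ := mul_le_mul_of_nonneg_right hl3 (div_nonneg (hρ l hl1) hpos.le)
      _ = ((2 : ℝ) ^ q) ^ p * ∑ l ∈ Finset.Ico 1 (2 ^ p), ρ l / (l : ℝ) ^ q := by
          rw [Finset.mul_sum]
      _ ≤ _ := by gcongr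
  have hr : (2 : ℝ) ^ q / 2 < 1 := by
    rw [div_lt_one (by norm_num)]
    calc (2 : ℝ) ^ q < 2 ^ (1 : ℝ) := Real.rpow_lt_rpow_of_exponent_lt (by norm_num) hq1
      _ = 2 := Real.rpow_one 2
  refine Summable.of_nonneg_of_le (fun p => ?_) (fun p => ?_)
    ((summable_sq_mul_geometric (by positivity) hr).mul_left (2 * C))
  · have : 0 ≤ ∑ l ∈ Finset.Ico 1 (2 ^ p), ρ l :=
      Finset.sum_nonneg fun l hl => hρ l (Finset.mem_Ico.1 hl).1
    positivity
  · have h4 : (4 : ℝ) ^ p = 2 ^ p * 2 ^ p := by rw [← mul_pow]; norm_num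
    calc _ ≤ ((p : ℝ) + 1) ^ 2 / 4 ^ p * (2 * 2 ^ p * (((2 : ℝ) ^ q) ^ p * C)) := by
          have := hbound p
          gcongr
      _ = _ := by
          rw [h4, div_pow]
          field_simp

/-- Strong law of large numbers for square-integrable variables under variance and covariance
restrictions. -/
theorem strong_law_of_covariance_le {Ω : Type*} [MeasurableSpace Ω] {P : Measure Ω}
    [IsProbabilityMeasure P] {X : ℕ → Ω → ℝ} (hX : ∀ k, 1 ≤ k → MemLp (X k) 2 P)
    (hvar : Summable fun k : ℕ => variance (X k) P * Real.log k ^ 2 / (k : ℝ) ^ 2)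
    {ρ : ℕ → ℝ} {q : ℝ} (hq0 : 0 ≤ q) (hq1 : q < 1)
    (hcov : ∀ l k : ℕ, 1 ≤ l → 1 ≤ k → |covariance (X k) (X (k + l)) P| ≤ ρ l)
    (hρ : Summable fun l : ℕ => ρ l / (l : ℝ) ^ q) :
    ∀ᵐ ω ∂P, Tendsto (fun N : ℕ =>
      (N : ℝ)⁻¹ * ∑ k ∈ Finset.Icc 1 N, (X k ω - ∫ ω', X k ω' ∂P)) atTop (𝓝 0) := by
  set Y : ℕ → Ω → ℝ := fun k ω => X k ω - ∫ ω', X k ω' ∂P with hYdef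
  have hY : ∀ k, 1 ≤ k → MemLp (Y k) 2 P := fun k hk => (hX k hk).sub (memLp_const _)
  -- Covariance is by definition the integral of the product of the centred variables.
  have hcovY : ∀ l k : ℕ, 1 ≤ l → 1 ≤ k → |∫ ω, Y k ω * Y (k + l) ω ∂P| ≤ ρ l := hcov
  have hρ0 : ∀ l, 1 ≤ l → 0 ≤ ρ l := fun l hl => (abs_nonneg _).trans (hcov l 1 hl le_rfl)
  have hsq : ∀ k, 1 ≤ k → ∫ ω, Y k ω ^ 2 ∂P = variance (X k) P := fun k hk =>
    (variance_eq_integral (hX k hk).aestronglyMeasurable.aemeasurable).symm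
  have hsum : Summable fun p : ℕ =>
      ∫ ω, ((p : ℝ) + 1) * dyadicEnergy (fun k => Y k ω) p (2 ^ p) / 4 ^ p ∂P := by
    refine Summable.of_nonneg_of_le (fun p => integral_nonneg fun ω => ?_) (fun p => ?_)
      ((summable_log_block (fun k => variance_nonneg (X k) P) hvar).add
        (summable_covariance_block hq0 hq1 hρ0 hρ))
    · have := dyadicEnergy_nonneg (fun k => Y k ω) p (2 ^ p)
      simp only [Pi.zero_apply]
      positivity
    · have h := integral_dyadicEnergy_le hY hcovY p (2 ^ p) Nat.one_le_two_pow
      simp only [hsq _ (Nat.one_le_two_pow.trans (Nat.le_add_right _ _))] at h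
      rw [integral_div, integral_const_mul, ← mul_add]
      rw [div_mul_eq_mul_div, div_le_div_iff_of_pos_right (by positivity), sq, mul_assoc]
      gcongr
  have hae := ae_summable_of_summable_integral
    (fun p => ((integrable_dyadicEnergy hY p (2 ^ p) Nat.one_le_two_pow).const_mul
      ((p : ℝ) + 1)).div_const (4 ^ p))
    (fun p ω => by
      have := dyadicEnergy_nonneg (fun k => Y k ω) p (2 ^ p)
      positivity) hsum
  filter_upwards [hae] with ω hω
  exact tendsto_average_of_dyadicEnergy (fun k => Y k ω) hω.tendsto_atTop_zero

/-! ### Debiasing polynomials and their expectations. -/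

theorem debiasPoly_eq (m : ℕ → ℝ) (h : ℕ) :
    debiasPoly m h = Polynomial.X ^ h -
      ∑ d ∈ Finset.range h,
        Polynomial.C ((h.choose (d + 1) : ℝ) * m (d + 1)) * debiasPoly m (h - (d + 1)) := by
  rw [debiasPoly, Finset.sum_range]

/-- This makes the finite list of coefficients used in `Mproc` the whole polynomial. -/
theorem natDegree_debiasPoly_le (m : ℕ → ℝ) (h : ℕ) : (debiasPoly m h).natDegree ≤ h := by
  induction h using Nat.strong_induction_on with
  | _ h ih =>
    rw [debiasPoly_eq]
    refine (Polynomial.natDegree_sub_le _ _).trans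
      (max_le (Polynomial.natDegree_X_pow (R := ℝ) h).le ?_)
    refine Polynomial.natDegree_sum_le_of_forall_le _ _ fun d hd => ?_
    have hd' := Finset.mem_range.1 hd
    exact (Polynomial.natDegree_C_mul_le _ _).trans ((ih _ (by omega)).trans (Nat.sub_le _ _))

theorem eval_debiasPoly_eq_sum (m : ℕ → ℝ) (h : ℕ) (t : ℝ) :
    (debiasPoly m h).eval t = ∑ i : Fin (h + 1), (debiasPoly m h).coeff i * t ^ (i : ℕ) := by
  rw [Polynomial.eval_eq_sum_range' (Nat.lt_succ_of_le (natDegree_debiasPoly_le m h)),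
    Finset.sum_range]

theorem eval_debiasPoly (m : ℕ → ℝ) (h : ℕ) (t : ℝ) :
    (debiasPoly m h).eval t = t ^ h -
      ∑ d ∈ Finset.range h,
        (h.choose (d + 1) : ℝ) * m (d + 1) * (debiasPoly m (h - (d + 1))).eval t := by
  rw [debiasPoly_eq]
  simp [Polynomial.eval_finsetSum]

section Debias

variable {Ω : Type*} {F mΩ : MeasurableSpace Ω} {P : Measure Ω} {e x G : Ω → ℝ}

theorem indepFun_of_measurable (hind : Indep (MeasurableSpace.comap e inferInstance) F P)
    {β : Type*} [MeasurableSpace β] {g : Ω → β} (hg : Measurable[F] g) : IndepFun e g P :=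
  indep_of_indep_of_le_right hind hg.comap_le

variable (hind : Indep (MeasurableSpace.comap e inferInstance) F P)
  (hx : Measurable[F] x) (hG : Measurable[F] G)

include hind hx hG

theorem integrable_mul_pow_add {h : ℕ} (hGx : ∀ i ≤ h, Integrable (fun ω => G ω * x ω ^ i) P)
    (hem : ∀ d ≤ h, Integrable (fun ω => e ω ^ d) P) {j : ℕ} (hj : j ≤ h) :
    Integrable (fun ω => G ω * (x ω + e ω) ^ j) P ∧
    ∫ ω, G ω * (x ω + e ω) ^ j ∂P =
      ∑ d ∈ Finset.range (j + 1),
        (j.choose d : ℝ) * (∫ ω, e ω ^ d ∂P) * ∫ ω, G ω * x ω ^ (j - d) ∂P := by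
  have hind' : ∀ d i, IndepFun (fun ω => e ω ^ d) (fun ω => G ω * x ω ^ i) P := fun d i =>
    (indepFun_of_measurable hind (hG.mul (hx.pow_const i))).comp
      (φ := fun t : ℝ => t ^ d) (ψ := id) (by fun_prop) measurable_id
  have hint : ∀ d ∈ Finset.range (j + 1), Integrable
      (fun ω => (j.choose d : ℝ) * (e ω ^ d * (G ω * x ω ^ (j - d)))) P := fun d hd => by
    have := Finset.mem_range.1 hd
    exact ((hind' d (j - d)).integrable_mul (hem d (by omega))
      (hGx (j - d) (by omega))).const_mul _
  have hexp : (fun ω => G ω * (x ω + e ω) ^ j) = fun ω => ∑ d ∈ Finset.range (j + 1),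
      (j.choose d : ℝ) * (e ω ^ d * (G ω * x ω ^ (j - d))) := by
    funext ω
    rw [add_comm (x ω), add_pow, Finset.mul_sum]
    exact Finset.sum_congr rfl fun d _ => by ring
  rw [hexp]
  refine ⟨integrable_finsetSum _ hint, ?_⟩
  rw [integral_finsetSum _ hint]
  refine Finset.sum_congr rfl fun d hd => ?_
  have := Finset.mem_range.1 hd
  rw [integral_const_mul, (hind' d (j - d)).integral_fun_mul_eq_mul_integral
    (hem d (by omega)).aestronglyMeasurable (hGx (j - d) (by omega)).aestronglyMeasurable]
  ring

/-- Substituting `P_j(x + e)` for `x ^ j` does not change the expectation of products with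
variables of the past. -/
theorem integral_mul_debiasPoly [IsProbabilityMeasure P] {m : ℕ → ℝ} {h : ℕ}
    (hGx : ∀ i ≤ h, Integrable (fun ω => G ω * x ω ^ i) P)
    (hem : ∀ d ≤ h, Integrable (fun ω => e ω ^ d) P)
    (hm : ∀ d ≤ h, m d = ∫ ω, e ω ^ d ∂P) {j : ℕ} (hj : j ≤ h) :
    Integrable (fun ω => G ω * (debiasPoly m j).eval (x ω + e ω)) P ∧
    ∫ ω, G ω * (debiasPoly m j).eval (x ω + e ω) ∂P = ∫ ω, G ω * x ω ^ j ∂P := by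
  induction j using Nat.strong_induction_on with
  | _ j ih =>
    obtain ⟨h1, h2⟩ := integrable_mul_pow_add hind hx hG hGx hem hj
    have hexp : (fun ω => G ω * (debiasPoly m j).eval (x ω + e ω)) =
        fun ω => G ω * (x ω + e ω) ^ j - ∑ d ∈ Finset.range j, (j.choose (d + 1) : ℝ) * m (d + 1) *
          (G ω * (debiasPoly m (j - (d + 1))).eval (x ω + e ω)) := by
      funext ω
      rw [eval_debiasPoly, mul_sub, Finset.mul_sum]
      congr 1
      exact Finset.sum_congr rfl fun d _ => by ring
    have hint : ∀ d ∈ Finset.range j, Integrable (fun ω => (j.choose (d + 1) : ℝ) * m (d + 1) *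
          (G ω * (debiasPoly m (j - (d + 1))).eval (x ω + e ω))) P := fun d hd => by
      have := Finset.mem_range.1 hd
      exact (ih (j - (d + 1)) (by omega) (by omega)).1.const_mul _
    rw [hexp]
    refine ⟨h1.sub (integrable_finsetSum _ hint), ?_⟩
    -- In the binomial expansion the terms d ≥ 1 cancel against the recursion, by induction; the
    -- term d = 0 is the claimed integral.
    rw [integral_sub h1 (integrable_finsetSum _ hint), integral_finsetSum _ hint, h2,
      Finset.sum_range_succ', add_comm, add_sub_assoc, sub_eq_zero.2, add_zero]
    · simp
    · refine Finset.sum_congr rfl fun d hd => ?_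
      have := Finset.mem_range.1 hd
      rw [integral_const_mul, (ih (j - (d + 1)) (by omega) (by omega)).2, hm (d + 1) (by omega)]

/-- Since x + e and e are dependent, noise moments cannot simply be multiplied in. Instead Fubini
freezes e at a typical value t, and x^j is recovered from the powers of x + t. -/
theorem memLp_mul_pow_of_memLp_mul_pow_add [IsProbabilityMeasure P] (hF : F ≤ mΩ)
    (he : Measurable e) {h : ℕ}
    (hGy : ∀ i ≤ h, MemLp (fun ω => G ω * (x ω + e ω) ^ i) 2 P) {j : ℕ} (hj : j ≤ h) :
    MemLp (fun ω => G ω * x ω ^ j) 2 P := by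
  have hGm : Measurable[mΩ] G := hG.mono hF le_rfl
  have hxm : Measurable[mΩ] x := hx.mono hF le_rfl
  have hpair : IndepFun e (fun ω => (G ω, x ω)) P :=
    indepFun_of_measurable hind (hG.prodMk hx)
  have hmap := (indepFun_iff_map_prod_eq_prod_map_map he.aemeasurable
    (hGm.prodMk hxm).aemeasurable).1 hpair
  have hae : ∀ i ≤ h, ∀ᵐ t ∂(P.map e), MemLp (fun ω => G ω * (x ω + t) ^ i) 2 P := by
    intro i hi
    have hf : Measurable fun z : ℝ × ℝ × ℝ => (z.2.1 * (z.2.2 + z.1) ^ i) ^ 2 := by fun_prop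
    have h1 : Integrable (fun z : ℝ × ℝ × ℝ => (z.2.1 * (z.2.2 + z.1) ^ i) ^ 2)
        ((P.map e).prod (P.map fun ω => (G ω, x ω))) := by
      rw [← hmap, integrable_map_measure hf.aestronglyMeasurable
        (he.prodMk (hGm.prodMk hxm)).aemeasurable]
      exact (hGy i hi).integrable_sq
    have : IsProbabilityMeasure (P.map e) := Measure.isProbabilityMeasure_map he.aemeasurable
    filter_upwards [h1.prod_right_ae] with t ht
    rw [memLp_two_iff_integrable_sq (by fun_prop)]
    rw [integrable_map_measure (by fun_prop) (hGm.prodMk hxm).aemeasurable] at ht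
    exact ht
  have hall : ∀ᵐ t ∂(P.map e), ∀ i ≤ h, MemLp (fun ω => G ω * (x ω + t) ^ i) 2 P :=
    ae_all_iff.2 fun i => by
      by_cases hi : i ≤ h
      · filter_upwards [hae i hi] with t ht _ using ht
      · exact Eventually.of_forall fun t ht => absurd ht hi
  have : IsProbabilityMeasure (P.map e) := Measure.isProbabilityMeasure_map he.aemeasurable
  -- One t must serve all exponents i ≤ h at once.
  obtain ⟨t, ht⟩ := hall.exists
  have hexp : (fun ω => G ω * x ω ^ j) = fun ω => ∑ i ∈ Finset.range (j + 1),
      ((-t) ^ (j - i) * (j.choose i : ℝ)) * (G ω * (x ω + t) ^ i) := by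
    funext ω
    have : x ω = (x ω + t) + -t := by ring
    conv_lhs => rw [this, add_pow, Finset.mul_sum]
    exact Finset.sum_congr rfl fun d _ => by ring
  rw [hexp]
  refine memLp_finsetSum _ fun i hi => (ht i ?_).const_mul _
  have := Finset.mem_range.1 hi
  omega

end Debias

/-! ### Matrix entries as monomials, and moment conditions for the data monomials. -/

/-- The part of a monomial with exponents `γ` that involves lagged outputs and inputs only. -/
noncomputable def lagMon {na nb : ℕ} (γ : RegIdx na nb → ℕ) (y u : ℤ → ℝ) (k : ℤ) : ℝ :=
  (∏ i : Fin na, y (k - ((i : ℕ) + 1)) ^ γ (Sum.inl i.succ)) *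
    ∏ j : Fin nb, u (k - ((j : ℕ) + 1)) ^ γ (Sum.inr j)

section Entries

variable {na nb n : ℕ}

theorem prod_dataVec_pow (γ : RegIdx na nb → ℕ) (y u : ℤ → ℝ) (k : ℤ) :
    ∏ i, dataVec na nb y u k i ^ γ i = lagMon γ y u k * y k ^ γ (Sum.inl 0) := by
  simp only [dataVec, lagMon, Fintype.prod_sum_type, Sum.elim_inl, Sum.elim_inr,
    Fin.prod_univ_succ]
  simp
  ring

theorem prod_regressor_pow (γ : RegIdx na nb → ℕ) (y ε u : ℤ → ℝ) (k : ℤ) :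
    ∏ i, regressor na nb y ε u k i ^ γ i = lagMon γ y u k * (y k - ε k) ^ γ (Sum.inl 0) := by
  simp only [regressor, lagMon, Fintype.prod_sum_type, Sum.elim_inl, Sum.elim_inr,
    Fin.prod_univ_succ]
  simp [Fin.succ_ne_zero]
  ring

theorem procMatrix_apply (y ε u : ℤ → ℝ) (k : ℤ) (α β : VeroneseIdx (RegIdx na nb) n) :
    procMatrix na nb n y ε u k α β =
      lagMon (α.1 + β.1) y u k * (y k - ε k) ^ (α.1 + β.1) (Sum.inl 0) := by
  rw [procMatrix, Matrix.vecMulVec_apply, veronese, veronese, ← Finset.prod_mul_distrib,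
    ← prod_regressor_pow]
  simp only [Pi.add_apply, pow_add]

theorem Mproc_apply (m : ℕ → ℝ) (v : MonIdx (RegIdx na nb) (2 * n) → ℝ)
    (α β : VeroneseIdx (RegIdx na nb) n) :
    Mproc na nb n m v α β = ∑ i : Fin ((α.1 + β.1) (Sum.inl 0) + 1),
      (debiasPoly m ((α.1 + β.1) (Sum.inl 0))).coeff i *
        v ⟨Function.update (α.1 + β.1) (Sum.inl 0) (i : ℕ), sum_update_le α β (Sum.inl 0) i⟩ :=
  rfl

theorem mon_update_apply (y u : ℤ → ℝ) (k : ℤ) {d : ℕ} (γ : RegIdx na nb → ℕ) (i : ℕ)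
    (hd : ∑ j, Function.update γ (Sum.inl 0) i j ≤ d) :
    mon d (dataVec na nb y u k) ⟨Function.update γ (Sum.inl 0) i, hd⟩ =
      lagMon γ y u k * y k ^ i := by
  rw [mon, prod_dataVec_pow]
  simp [lagMon]

theorem Mproc_mon_apply (m : ℕ → ℝ) (y u : ℤ → ℝ) (k : ℤ)
    (α β : VeroneseIdx (RegIdx na nb) n) :
    Mproc na nb n m (mon (2 * n) (dataVec na nb y u k)) α β = lagMon (α.1 + β.1) y u k *
      (debiasPoly m ((α.1 + β.1) (Sum.inl 0))).eval (y k) := by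
  rw [Mproc_apply, eval_debiasPoly_eq_sum, Finset.mul_sum]
  refine Finset.sum_congr rfl fun i _ => ?_
  rw [mon_update_apply]
  ring

theorem mon_dataVec_eq_mul_outMon {d : ℕ} (y u : ℤ → ℝ) (k : ℤ) (γ : MonIdx (RegIdx na nb) d) :
    mon d (dataVec na nb y u k) γ =
      (∏ j : Fin nb, u (k - ((j : ℕ) + 1)) ^ γ.1 (Sum.inr j)) *
        outMon (fun i => γ.1 (Sum.inl i)) y k := by
  rw [mon, Fintype.prod_sum_type, mul_comm]
  rfl

theorem sum_inl_le {d : ℕ} (γ : MonIdx (RegIdx na nb) d) : ∑ i, γ.1 (Sum.inl i) ≤ d := by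
  have := γ.2
  rw [Fintype.sum_sum_type] at this
  omega

theorem exists_abs_prod_input_le {u : ℤ → ℝ}
    (hu : ∃ L : ℝ, ∀ k : ℤ, 1 - (nb : ℤ) ≤ k → |u k| ≤ L) (γ : Fin nb → ℕ) :
    ∃ C : ℝ, ∀ k : ℕ, 1 ≤ k → |∏ j : Fin nb, u ((k : ℤ) - ((j : ℕ) + 1)) ^ γ j| ≤ C := by
  obtain ⟨L, hL⟩ := hu
  refine ⟨∏ j, L ^ γ j, fun k hk => ?_⟩
  rw [Finset.abs_prod]
  refine Finset.prod_le_prod (fun j _ => abs_nonneg _) fun j _ => ?_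
  rw [abs_pow]
  have hj := j.2
  exact pow_le_pow_left₀ (abs_nonneg _) (hL _ (by omega)) _

end Entries

section Monomials

variable {Ω : Type*} [MeasurableSpace Ω] {P : Measure Ω} {na nb n : ℕ} {u : ℤ → ℝ}
  {y : ℤ → Ω → ℝ}

theorem memLp_mon
    (hL2 : ∀ h : Fin (na + 1) → ℕ, ∑ i, h i ≤ 2 * n → ∀ k : ℕ, 1 ≤ k →
      MemLp (fun ω => outMon h (path y ω) k) 2 P)
    (γ : MonIdx (RegIdx na nb) (2 * n)) (k : ℕ) (hk : 1 ≤ k) :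
    MemLp (fun ω => mon (2 * n) (dataVec na nb (path y ω) u k) γ) 2 P := by
  simp only [mon_dataVec_eq_mul_outMon]
  exact (hL2 _ (sum_inl_le γ) k hk).const_mul _

theorem memLp_Mproc_mon
    (hL2 : ∀ h : Fin (na + 1) → ℕ, ∑ i, h i ≤ 2 * n → ∀ k : ℕ, 1 ≤ k →
      MemLp (fun ω => outMon h (path y ω) k) 2 P)
    (α β : VeroneseIdx (RegIdx na nb) n) (m : ℕ → ℝ) {k : ℕ} (hk : 1 ≤ k) :
    MemLp (fun ω => Mproc na nb n m (mon (2 * n) (dataVec na nb (path y ω) u k)) α β) 2 P := by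
  simp only [Mproc_apply]
  exact memLp_finsetSum _ fun i _ => (memLp_mon hL2 _ k hk).const_mul _

theorem summable_variance_mon
    (hu : ∃ L : ℝ, ∀ k : ℤ, 1 - (nb : ℤ) ≤ k → |u k| ≤ L)
    (hvar : ∀ h : Fin (na + 1) → ℕ, ∑ i, h i ≤ 2 * n →
      Summable fun k : ℕ =>
        variance (fun ω => outMon h (path y ω) k) P * Real.log k ^ 2 / (k : ℝ) ^ 2)
    (γ : MonIdx (RegIdx na nb) (2 * n)) :
    Summable fun k : ℕ =>
      variance (fun ω => mon (2 * n) (dataVec na nb (path y ω) u k) γ) P *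
        Real.log k ^ 2 / (k : ℝ) ^ 2 := by
  obtain ⟨C, hC⟩ := exists_abs_prod_input_le hu fun j => γ.1 (Sum.inr j)
  refine Summable.of_nonneg_of_le (fun k => ?_) (fun k => ?_)
    ((hvar _ (sum_inl_le γ)).mul_left (C ^ 2))
  · exact div_nonneg (mul_nonneg (variance_nonneg _ _) (sq_nonneg _)) (sq_nonneg _)
  · rcases Nat.eq_zero_or_pos k with rfl | hk
    · simp
    · simp only [mon_dataVec_eq_mul_outMon]
      rw [variance_const_mul, mul_assoc, mul_div_assoc]
      refine mul_le_mul_of_nonneg_right ?_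
        (div_nonneg (mul_nonneg (variance_nonneg _ _) (sq_nonneg _)) (sq_nonneg _))
      rw [← sq_abs]
      exact pow_le_pow_left₀ (abs_nonneg _) (hC k hk) 2

/-- The inputs are deterministic, so they leave the covariance as two bounded factors, one for each
time; ρ is scaled by C² and q is kept. -/
theorem exists_covariance_mon_le
    (hu : ∃ L : ℝ, ∀ k : ℤ, 1 - (nb : ℤ) ≤ k → |u k| ≤ L)
    (hcov : ∀ h : Fin (na + 1) → ℕ, ∑ i, h i ≤ 2 * n →
      ∃ (ρ : ℕ → ℝ) (q : ℝ), 0 ≤ q ∧ q < 1 ∧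
        (∀ l k : ℕ, 1 ≤ l → 1 ≤ k →
          |covariance (fun ω => outMon h (path y ω) k)
            (fun ω => outMon h (path y ω) ((k + l : ℕ) : ℤ)) P| ≤ ρ l) ∧
        Summable fun l : ℕ => ρ l / (l : ℝ) ^ q)
    (γ : MonIdx (RegIdx na nb) (2 * n)) :
    ∃ (ρ : ℕ → ℝ) (q : ℝ), 0 ≤ q ∧ q < 1 ∧
      (∀ l k : ℕ, 1 ≤ l → 1 ≤ k →
        |covariance (fun ω => mon (2 * n) (dataVec na nb (path y ω) u k) γ)
          (fun ω => mon (2 * n) (dataVec na nb (path y ω) u ((k + l : ℕ) : ℤ)) γ) P| ≤ ρ l) ∧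
      Summable fun l : ℕ => ρ l / (l : ℝ) ^ q := by
  obtain ⟨C, hC⟩ := exists_abs_prod_input_le hu fun j => γ.1 (Sum.inr j)
  obtain ⟨ρ, q, hq0, hq1, hρ, hs⟩ := hcov _ (sum_inl_le γ)
  refine ⟨fun l => C * (C * ρ l), q, hq0, hq1, fun l k hl hk => ?_, ?_⟩
  · have hC0 : 0 ≤ C := (abs_nonneg _).trans (hC k hk)
    simp only [mon_dataVec_eq_mul_outMon]
    rw [covariance_const_mul_left, covariance_const_mul_right, abs_mul, abs_mul]
    gcongr
    · exact hC k hk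
    · exact hC (k + l) (by omega)
    · exact hρ l k hl hk
  · refine (hs.mul_left (C * C)).congr fun l => ?_
    ring

end Monomials

/-! ### The past σ-algebra and the dynamics. -/

section Past

variable {Ω : Type*} {na nb n : ℕ} {δ : ℤ → Ω → Fin n} {u : ℤ → ℝ} {y : ℤ → Ω → ℝ}

/-- The σ-algebra of the outputs before time `k` and the modes up to time `k`. -/
abbrev pastSigma {n : ℕ} (na : ℕ) (δ : ℤ → Ω → Fin n) (y : ℤ → Ω → ℝ) (k : ℤ) :
    MeasurableSpace Ω :=
  MeasurableSpace.comap (fun ω => ((fun j : Set.Ico (1 - (na : ℤ)) k => y j ω),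
      (fun j : Set.Icc (1 : ℤ) k => δ j ω))) inferInstance

theorem measurable_output_pastSigma {j k : ℤ} (h1 : 1 - (na : ℤ) ≤ j) (h2 : j < k) :
    Measurable[pastSigma na δ y k] (y j) := by
  have h := comap_measurable (m := inferInstance) (fun ω => ((fun j : Set.Ico (1 - (na : ℤ)) k => y j ω),
      (fun j : Set.Icc (1 : ℤ) k => δ j ω)))
  exact (measurable_pi_apply (⟨j, h1, h2⟩ : Set.Ico (1 - (na : ℤ)) k)).comp
    (measurable_fst.comp h)

theorem measurable_mode_pastSigma {j k : ℤ} (h1 : 1 ≤ j) (h2 : j ≤ k) :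
    Measurable[pastSigma na δ y k] (δ j) := by
  have h := comap_measurable (m := inferInstance) (fun ω => ((fun j : Set.Ico (1 - (na : ℤ)) k => y j ω),
      (fun j : Set.Icc (1 : ℤ) k => δ j ω)))
  exact (measurable_pi_apply (⟨j, h1, h2⟩ : Set.Icc (1 : ℤ) k)).comp (measurable_snd.comp h)

theorem measurable_lagMon_pastSigma (γ : RegIdx na nb → ℕ) {j k : ℤ} (h1 : 1 ≤ j) (h2 : j ≤ k) :
    Measurable[pastSigma na δ y k] (fun ω => lagMon γ (path y ω) u j) := by
  refine Measurable.mul_const (Finset.measurable_fun_prod _ fun i _ => ?_) _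
  have hi := i.2
  exact (measurable_output_pastSigma (j := j - ((i : ℕ) + 1)) (by omega) (by omega)).pow_const _

end Past

section System

variable {Ω : Type*} [mΩ : MeasurableSpace Ω] {P : Measure Ω} {na nb n : ℕ}
  {a : Fin na → Fin n → ℝ} {b : Fin nb → Fin n → ℝ} {δ : ℤ → Ω → Fin n} {u : ℤ → ℝ}
  {y ε : ℤ → Ω → ℝ}

theorem IsSARX.pastSigma_le (hsys : IsSARX P a b δ u y ε) (k : ℤ) :
    pastSigma na δ y k ≤ mΩ := by
  refine Measurable.comap_le (Measurable.prodMk ?_ ?_)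
  · exact measurable_pi_lambda _ fun j => hsys.measurable_output j j.2.1
  · exact measurable_pi_lambda _ fun j => hsys.measurable_mode j j.2.1

/-- By the dynamics, y_j - ε_j is built from earlier outputs, the inputs and the mode δ_j; this is
why the past must include the mode at the current time. -/
theorem IsSARX.measurable_drift_pastSigma (hsys : IsSARX P a b δ u y ε) {j k : ℤ}
    (h1 : 1 ≤ j) (h2 : j ≤ k) :
    Measurable[pastSigma na δ y k] (fun ω => y j ω - ε j ω) := by
  have : (fun ω => y j ω - ε j ω) = fun ω =>
      ∑ i : Fin na, a i (δ j ω) * y (j - ((i : ℕ) + 1)) ω +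
        ∑ i : Fin nb, b i (δ j ω) * u (j - ((i : ℕ) + 1)) := by
    funext ω
    rw [hsys.dynamics j h1 ω]
    ring
  rw [this]
  have hδ : Measurable[pastSigma na δ y k] (δ j) := measurable_mode_pastSigma h1 h2
  refine Measurable.add (Finset.measurable_fun_sum _ fun i _ => ?_)
    (Finset.measurable_fun_sum _ fun i _ => ?_)
  · have hi := i.2
    exact ((measurable_from_top (f := a i)).comp hδ).mul
      (measurable_output_pastSigma (by omega) (by omega))
  · exact ((measurable_from_top (f := b i)).comp hδ).mul_const _

theorem IsSARX.integrable_noise_pow [IsProbabilityMeasure P] (hsys : IsSARX P a b δ u y ε) {k : ℤ}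
    (hk : 1 ≤ k) {d : ℕ} (hd : d ≤ 4 * n) : Integrable (fun ω => ε k ω ^ d) P := by
  have h1 : MemLp (ε k) ((4 * n : ℕ) : ENNReal) P :=
    (hsys.noise_identDistrib k hk).memLp_iff.2 hsys.noise_moments
  have h2 : MemLp (ε k) (d : ENNReal) P := h1.mono_exponent (by exact_mod_cast hd)
  refine h2.integrable_norm_pow'.mono'
    ((hsys.measurable_noise k hk).pow_const d).aestronglyMeasurable (Eventually.of_forall fun ω => ?_)
  simp

theorem IsSARX.noiseMoment_eq (hsys : IsSARX P a b δ u y ε) {k : ℤ} (hk : 1 ≤ k) (d : ℕ) :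
    noiseMoment P ε d = ∫ ω, ε k ω ^ d ∂P :=
  (((hsys.noise_identDistrib k hk).comp (u := fun t : ℝ => t ^ d) (by fun_prop)).integral_eq).symm

end System

/-! ### The substitution error: orthogonality and convergence of its averages. -/

theorem variance_sum_le_card_mul {Ω ι : Type*} [MeasurableSpace Ω] {P : Measure Ω}
    [IsProbabilityMeasure P] [Fintype ι] {X : ι → Ω → ℝ} (hX : ∀ i, MemLp (X i) 2 P) :
    variance (fun ω => ∑ i, X i ω) P ≤ Fintype.card ι * ∑ i, variance (X i) P := by
  have hi : ∀ i, Integrable (fun ω => (X i ω - ∫ ω', X i ω' ∂P) ^ 2) P := fun i =>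
    ((hX i).sub (memLp_const _)).integrable_sq
  have hS : MemLp (fun ω => ∑ i, X i ω) 2 P := memLp_finsetSum _ fun i _ => hX i
  have hvar : ∀ i, variance (X i) P = ∫ ω, (X i ω - ∫ ω', X i ω' ∂P) ^ 2 ∂P := fun i =>
    variance_eq_integral (hX i).aestronglyMeasurable.aemeasurable
  simp only [hvar]
  rw [variance_eq_integral hS.aestronglyMeasurable.aemeasurable,
    integral_finsetSum _ fun i _ => (hX i).integrable one_le_two,
    ← integral_finsetSum _ fun i _ => hi i, ← integral_const_mul]
  refine integral_mono (hS.sub (memLp_const _)).integrable_sq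
    ((integrable_finsetSum _ fun i _ => hi i).const_mul _) fun ω => ?_
  simp only [← Finset.sum_sub_distrib]
  exact sq_sum_le_card_mul_sum_sq

section Error

variable {Ω : Type*} [mΩ : MeasurableSpace Ω] {P : Measure Ω}
  {na nb n : ℕ} {a : Fin na → Fin n → ℝ} {b : Fin nb → Fin n → ℝ} {δ : ℤ → Ω → Fin n}
  {u : ℤ → ℝ} {y ε : ℤ → Ω → ℝ}

/-- The error made in an entry of `M_k^proc` when `(y_k - ε_k)^h` is replaced by `P_h(y_k)`. -/
noncomputable def debiasError (P : Measure Ω) (u : ℤ → ℝ) (y ε : ℤ → Ω → ℝ)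
    (α β : VeroneseIdx (RegIdx na nb) n) (k : ℤ) (ω : Ω) : ℝ :=
  Mproc na nb n (noiseMoment P ε) (mon (2 * n) (dataVec na nb (path y ω) u k)) α β -
    procMatrix na nb n (path y ω) (path ε ω) u k α β

theorem exponent_le (α β : VeroneseIdx (RegIdx na nb) n) :
    (α.1 + β.1) (Sum.inl 0) ≤ 2 * n := by
  have h1 := Finset.single_le_sum (f := α.1) (fun _ _ => Nat.zero_le _)
    (Finset.mem_univ (Sum.inl 0))
  have h2 := Finset.single_le_sum (f := β.1) (fun _ _ => Nat.zero_le _)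
    (Finset.mem_univ (Sum.inl 0))
  rw [α.2] at h1
  rw [β.2] at h2
  simp only [Pi.add_apply]
  omega

theorem measurable_debiasError_pastSigma (hsys : IsSARX P a b δ u y ε)
    (α β : VeroneseIdx (RegIdx na nb) n) {j k : ℤ} (h1 : 1 ≤ j) (h2 : j < k) :
    Measurable[pastSigma na δ y k] (debiasError P u y ε α β j) := by
  unfold debiasError
  simp only [Mproc_mon_apply, procMatrix_apply]
  have hlag : Measurable[pastSigma na δ y k] (fun ω => lagMon (α.1 + β.1) (path y ω) u j) :=
    measurable_lagMon_pastSigma _ h1 h2.le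
  refine (hlag.mul ?_).sub
    (hlag.mul ((hsys.measurable_drift_pastSigma h1 h2.le).pow_const _))
  exact (Polynomial.continuous _).measurable.comp (measurable_output_pastSigma (by omega) h2)

variable [IsProbabilityMeasure P] (hsys : IsSARX P a b δ u y ε)
  (hL2 : ∀ h : Fin (na + 1) → ℕ, ∑ i, h i ≤ 2 * n → ∀ k : ℕ, 1 ≤ k →
    MemLp (fun ω => outMon h (path y ω) k) 2 P)
  (α β : VeroneseIdx (RegIdx na nb) n)

include hsys hL2

theorem memLp_lagMon_mul_drift_pow {k : ℕ} (hk : 1 ≤ k) {i : ℕ}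
    (hi : i ≤ (α.1 + β.1) (Sum.inl 0)) :
    MemLp (fun ω => lagMon (α.1 + β.1) (path y ω) u k * (y k ω - ε k ω) ^ i) 2 P := by
  have hk' : (1 : ℤ) ≤ k := by exact_mod_cast hk
  refine memLp_mul_pow_of_memLp_mul_pow_add (hsys.noise_indep_past k hk')
    (hsys.measurable_drift_pastSigma hk' le_rfl) (measurable_lagMon_pastSigma _ hk' le_rfl)
    (hsys.pastSigma_le k) (hsys.measurable_noise k hk') (fun j hj => ?_) hi
  -- Lowering the exponent of the current output keeps the degree at most 2n, so the assumption on
  -- output monomials still applies.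
  have h := memLp_mon (u := u) hL2 ⟨Function.update (α.1 + β.1) (Sum.inl 0) j,
    sum_update_le α β (Sum.inl 0) ⟨j, Nat.lt_succ_of_le hj⟩⟩ k hk
  simp only [mon_update_apply] at h
  simp only [sub_add_cancel]
  exact h

theorem memLp_procMatrix {k : ℕ} (hk : 1 ≤ k) :
    MemLp (fun ω => procMatrix na nb n (path y ω) (path ε ω) u k α β) 2 P := by
  simp only [procMatrix_apply]
  exact memLp_lagMon_mul_drift_pow hsys hL2 α β hk le_rfl

theorem memLp_debiasError {k : ℕ} (hk : 1 ≤ k) : MemLp (debiasError P u y ε α β k) 2 P :=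
  (memLp_Mproc_mon hL2 α β _ hk).sub (memLp_procMatrix hsys hL2 α β hk)

/-- The error is orthogonal to the past. -/
theorem integral_mul_debiasError {k : ℕ} (hk : 1 ≤ k) {Q : Ω → ℝ}
    (hQ : Measurable[pastSigma na δ y k] Q) (hQ2 : MemLp Q 2 P) :
    ∫ ω, Q ω * debiasError P u y ε α β k ω ∂P = 0 := by
  have hk' : (1 : ℤ) ≤ k := by exact_mod_cast hk
  have hh := exponent_le α β
  have hGx : ∀ i ≤ (α.1 + β.1) (Sum.inl 0), Integrable (fun ω =>
      Q ω * lagMon (α.1 + β.1) (path y ω) u k * (y k ω - ε k ω) ^ i) P := fun i hi => by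
    simp only [mul_assoc]
    exact hQ2.integrable_mul (memLp_lagMon_mul_drift_pow hsys hL2 α β hk hi)
  obtain ⟨h1, h2⟩ := integral_mul_debiasPoly (m := noiseMoment P ε)
    (hsys.noise_indep_past k hk') (hsys.measurable_drift_pastSigma hk' le_rfl)
    -- The past factor G is the product of Q and the lagged part of the entry.
    (hQ.mul (measurable_lagMon_pastSigma (u := u) (α.1 + β.1) hk' le_rfl))
    hGx (fun d hd => hsys.integrable_noise_pow hk' (by omega))
    (fun d _ => hsys.noiseMoment_eq hk' d) le_rfl
  have hexp : ∀ ω, Q ω * debiasError P u y ε α β k ω =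
      Q ω * lagMon (α.1 + β.1) (path y ω) u k * (debiasPoly (noiseMoment P ε)
          ((α.1 + β.1) (Sum.inl 0))).eval ((y k ω - ε k ω) + ε k ω) -
        Q ω * lagMon (α.1 + β.1) (path y ω) u k *
          (y k ω - ε k ω) ^ (α.1 + β.1) (Sum.inl 0) := by
    intro ω
    rw [debiasError, Mproc_mon_apply, procMatrix_apply, sub_add_cancel]
    simp only [path]
    ring
  simp only [hexp]
  exact (integral_sub h1 (hGx _ le_rfl)).trans (sub_eq_zero.2 h2)

theorem integral_debiasError {k : ℕ} (hk : 1 ≤ k) :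
    ∫ ω, debiasError P u y ε α β k ω ∂P = 0 := by
  simpa using integral_mul_debiasError hsys hL2 α β hk (Q := fun _ => 1) measurable_const
    (memLp_const 1)

/-- The true entry is itself past-measurable, so the debiased entry is an orthogonal sum of error
and true entry, up to the mean. No separate variance assumption on noise-dependent terms is needed.
-/
theorem variance_debiasError_le {k : ℕ} (hk : 1 ≤ k) :
    variance (debiasError P u y ε α β k) P ≤ variance (fun ω =>
      Mproc na nb n (noiseMoment P ε) (mon (2 * n) (dataVec na nb (path y ω) u k)) α β) P := by
  have hk' : (1 : ℤ) ≤ k := by exact_mod_cast hk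
  have hD := memLp_debiasError hsys hL2 α β hk
  have hV := memLp_procMatrix hsys hL2 α β hk
  have hVm : Measurable[pastSigma na δ y k]
      (fun ω => procMatrix na nb n (path y ω) (path ε ω) u k α β) := by
    simp only [procMatrix_apply]
    exact (measurable_lagMon_pastSigma _ hk' le_rfl).mul
      ((hsys.measurable_drift_pastSigma hk' le_rfl).pow_const _)
  have hcov : covariance (debiasError P u y ε α β k)
      (fun ω => procMatrix na nb n (path y ω) (path ε ω) u k α β) P = 0 := by
    rw [covariance_comm, covariance_eq_sub hV hD, integral_debiasError hsys hL2 α β hk, mul_zero,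
      sub_zero]
    exact integral_mul_debiasError hsys hL2 α β hk hVm hV
  have hsum : (fun ω => Mproc na nb n (noiseMoment P ε)
      (mon (2 * n) (dataVec na nb (path y ω) u k)) α β) = fun ω =>
        debiasError P u y ε α β k ω + procMatrix na nb n (path y ω) (path ε ω) u k α β := by
    funext ω
    rw [debiasError, sub_add_cancel]
  rw [hsum, variance_fun_add hD hV, hcov]
  linarith [variance_nonneg (fun ω => procMatrix na nb n (path y ω) (path ε ω) u k α β) P]

theorem summable_variance_debiasError
    (hvar : ∀ h : Fin (na + 1) → ℕ, ∑ i, h i ≤ 2 * n →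
      Summable fun k : ℕ =>
        variance (fun ω => outMon h (path y ω) k) P * Real.log k ^ 2 / (k : ℝ) ^ 2) :
    Summable fun k : ℕ => variance (debiasError P u y ε α β k) P *
      Real.log k ^ 2 / (k : ℝ) ^ 2 := by
  have hs := (summable_sum (s := Finset.univ) fun (i : Fin ((α.1 + β.1) (Sum.inl 0) + 1)) _ =>
    (summable_variance_mon hsys.input_bounded hvar
      ⟨Function.update (α.1 + β.1) (Sum.inl 0) (i : ℕ), sum_update_le α β (Sum.inl 0) i⟩).mul_left
      ((debiasPoly (noiseMoment P ε) ((α.1 + β.1) (Sum.inl 0))).coeff i ^ 2)).mul_left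
      (Fintype.card (Fin ((α.1 + β.1) (Sum.inl 0) + 1)) : ℝ)
  refine Summable.of_nonneg_of_le (fun k => ?_) (fun k => ?_) hs
  · exact div_nonneg (mul_nonneg (variance_nonneg _ _) (sq_nonneg _)) (sq_nonneg _)
  · rcases Nat.eq_zero_or_pos k with rfl | hk
    · simp
    · have h1 := variance_debiasError_le hsys hL2 α β hk
      simp only [Mproc_apply] at h1
      have h2 := h1.trans (variance_sum_le_card_mul fun i => (memLp_mon hL2 _ k hk).const_mul _)
      simp only [variance_const_mul] at h2
      rw [mul_div_assoc]
      refine (mul_le_mul_of_nonneg_right h2 (by positivity)).trans (le_of_eq ?_)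
      rw [mul_assoc, Finset.sum_mul]
      congr 1
      exact Finset.sum_congr rfl fun i _ => by ring

theorem ae_tendsto_average_debiasError
    (hvar : ∀ h : Fin (na + 1) → ℕ, ∑ i, h i ≤ 2 * n →
      Summable fun k : ℕ =>
        variance (fun ω => outMon h (path y ω) k) P * Real.log k ^ 2 / (k : ℝ) ^ 2) :
    ∀ᵐ ω ∂P, Tendsto (fun N : ℕ =>
      (N : ℝ)⁻¹ * ∑ k ∈ Finset.Icc 1 N, debiasError P u y ε α β k ω) atTop (𝓝 0) := by
  have h := strong_law_of_covariance_le (P := P) (X := fun k : ℕ => debiasError P u y ε α β k)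
    (ρ := fun _ => 0) (q := 0) (fun k hk => memLp_debiasError hsys hL2 α β hk)
    (summable_variance_debiasError hsys hL2 α β hvar) le_rfl one_pos (fun l k hl hk => by
      have hkl : 1 ≤ k + l := by omega
      rw [covariance_eq_sub (memLp_debiasError hsys hL2 α β hk)
        (memLp_debiasError hsys hL2 α β hkl), integral_debiasError hsys hL2 α β hk, zero_mul,
        sub_zero]
      refine (abs_eq_zero.2 ?_).le
      -- The earlier error plays the role of the past variable for the later one.
      exact integral_mul_debiasError hsys hL2 α β hkl
        (measurable_debiasError_pastSigma hsys α β (by exact_mod_cast hk) (by omega))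
        (memLp_debiasError hsys hL2 α β hk)) (by simp)
  filter_upwards [h] with ω hω
  refine hω.congr fun N => ?_
  congr 1
  refine Finset.sum_congr rfl fun k hk => ?_
  rw [integral_debiasError hsys hL2 α β (Finset.mem_Icc.1 hk).1, sub_zero]

end Error

/-! ### From entries to matrices. -/

section Matrices

variable {na nb n : ℕ}

theorem avgProcMatrix_apply (y ε u : ℤ → ℝ) (N : ℕ) (α β : VeroneseIdx (RegIdx na nb) n) :
    avgProcMatrix na nb n y ε u N α β =
      (N : ℝ)⁻¹ * ∑ k ∈ Finset.Icc 1 N, procMatrix na nb n y ε u (k : ℤ) α β := by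
  simp [avgProcMatrix, Matrix.sum_apply]

theorem empMatrix_apply (m : ℕ → ℝ) (y u : ℤ → ℝ) (N : ℕ)
    (α β : VeroneseIdx (RegIdx na nb) n) :
    empMatrix na nb n m y u N α β = (N : ℝ)⁻¹ * ∑ k ∈ Finset.Icc 1 N,
      Mproc na nb n m (mon (2 * n) (dataVec na nb y u (k : ℤ))) α β := by
  simp [empMatrix, Matrix.sum_apply]

end Matrices

theorem ae_tendsto_matrix_zero {Ω ι κ : Type*} [MeasurableSpace Ω] {P : Measure Ω} [Countable ι]
    [Countable κ] {A : ℕ → Ω → Matrix ι κ ℝ}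
    (h : ∀ i j, ∀ᵐ ω ∂P, Tendsto (fun N => A N ω i j) atTop (𝓝 0)) :
    ∀ᵐ ω ∂P, Tendsto (fun N => A N ω) atTop (𝓝 0) := by
  filter_upwards [ae_all_iff.2 fun i => ae_all_iff.2 (h i)] with ω hω
  exact tendsto_pi_nhds.2 fun i => tendsto_pi_nhds.2 fun j => hω i j

end SARX

theorem theorem2 {Ω : Type*} [MeasurableSpace Ω] (P : Measure Ω) [IsProbabilityMeasure P]
    {na nb n : ℕ} (a : Fin na → Fin n → ℝ) (b : Fin nb → Fin n → ℝ)
    (δ : ℤ → Ω → Fin n) (u : ℤ → ℝ) (y ε : ℤ → Ω → ℝ)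
    (hsys : IsSARX P a b δ u y ε)
    (hL2 : ∀ h : Fin (na + 1) → ℕ, ∑ i, h i ≤ 2 * n → ∀ k : ℕ, 1 ≤ k →
      MemLp (fun ω => outMon h (path y ω) k) 2 P)
    (hvar : ∀ h : Fin (na + 1) → ℕ, ∑ i, h i ≤ 2 * n →
      Summable fun k : ℕ =>
        variance (fun ω => outMon h (path y ω) k) P * Real.log k ^ 2 / (k : ℝ) ^ 2)
    (hcov : ∀ h : Fin (na + 1) → ℕ, ∑ i, h i ≤ 2 * n →
      ∃ (ρ : ℕ → ℝ) (q : ℝ), 0 ≤ q ∧ q < 1 ∧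
        (∀ l k : ℕ, 1 ≤ l → 1 ≤ k →
          |covariance (fun ω => outMon h (path y ω) k)
            (fun ω => outMon h (path y ω) ((k + l : ℕ) : ℤ)) P| ≤ ρ l) ∧
        Summable fun l : ℕ => ρ l / (l : ℝ) ^ q) :
    -- `M_proc` is unbiased: `E[M_k^proc] = E[M_proc(mon)] = M_proc(E[mon])`, entry by entry
    (∀ k : ℕ, 1 ≤ k → ∀ α β : VeroneseIdx (RegIdx na nb) n,
      (∀ γ, Integrable (fun ω => mon (2 * n) (dataVec na nb (path y ω) u k) γ) P) ∧
      Integrable (fun ω => procMatrix na nb n (path y ω) (path ε ω) u k α β) P ∧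
      ∫ ω, procMatrix na nb n (path y ω) (path ε ω) u k α β ∂P =
        ∫ ω, Mproc na nb n (noiseMoment P ε)
          (mon (2 * n) (dataVec na nb (path y ω) u k)) α β ∂P ∧
      ∫ ω, Mproc na nb n (noiseMoment P ε)
          (mon (2 * n) (dataVec na nb (path y ω) u k)) α β ∂P =
        Mproc na nb n (noiseMoment P ε)
          (fun γ => ∫ ω, mon (2 * n) (dataVec na nb (path y ω) u k) γ ∂P) α β) ∧
    -- the empirical matrix minus the noise-dependent matrix tends to zero
    (∀ᵐ ω ∂P, Tendsto (fun N : ℕ =>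
      empMatrix na nb n (noiseMoment P ε) (path y ω) u N -
        avgProcMatrix na nb n (path y ω) (path ε ω) u N) atTop (𝓝 0)) ∧
    -- and so does its difference from the expectation of the latter
    (∀ᵐ ω ∂P, Tendsto (fun N : ℕ =>
      empMatrix na nb n (noiseMoment P ε) (path y ω) u N -
        Matrix.of (fun α β => ∫ ω', avgProcMatrix na nb n
          (path y ω') (path ε ω') u N α β ∂P)) atTop (𝓝 0)) := by
  have hmean : ∀ k : ℕ, 1 ≤ k → ∀ α β : VeroneseIdx (RegIdx na nb) n,
      (∀ γ, Integrable (fun ω => mon (2 * n) (dataVec na nb (path y ω) u k) γ) P) ∧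
      Integrable (fun ω => procMatrix na nb n (path y ω) (path ε ω) u k α β) P ∧
      ∫ ω, procMatrix na nb n (path y ω) (path ε ω) u k α β ∂P =
        ∫ ω, Mproc na nb n (noiseMoment P ε)
          (mon (2 * n) (dataVec na nb (path y ω) u k)) α β ∂P ∧
      ∫ ω, Mproc na nb n (noiseMoment P ε)
          (mon (2 * n) (dataVec na nb (path y ω) u k)) α β ∂P =
        Mproc na nb n (noiseMoment P ε)
          (fun γ => ∫ ω, mon (2 * n) (dataVec na nb (path y ω) u k) γ ∂P) α β := by
    intro k hk α β
    have hmon : ∀ γ, Integrable (fun ω => mon (2 * n) (dataVec na nb (path y ω) u k) γ) P :=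
      fun γ => (memLp_mon hL2 γ k hk).integrable one_le_two
    have hproc := (memLp_procMatrix hsys hL2 α β hk).integrable one_le_two
    refine ⟨hmon, hproc, ?_, ?_⟩
    · have h := integral_debiasError hsys hL2 α β hk
      simp only [debiasError] at h
      rw [integral_sub ((memLp_Mproc_mon hL2 α β _ hk).integrable one_le_two) hproc] at h
      exact (sub_eq_zero.1 h).symm
    · simp only [Mproc_apply]
      rw [integral_finsetSum _ fun i _ => (hmon _).const_mul _]
      simp only [integral_const_mul]
  refine ⟨hmean, ae_tendsto_matrix_zero fun α β => ?_, ae_tendsto_matrix_zero fun α β => ?_⟩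
  · filter_upwards [ae_tendsto_average_debiasError hsys hL2 α β hvar] with ω hω
    refine hω.congr fun N => ?_
    rw [Matrix.sub_apply, empMatrix_apply, avgProcMatrix_apply, ← mul_sub,
      ← Finset.sum_sub_distrib]
    rfl
  · have hmon : ∀ γ : MonIdx (RegIdx na nb) (2 * n), ∀ᵐ ω ∂P, Tendsto (fun N : ℕ =>
        (N : ℝ)⁻¹ * ∑ k ∈ Finset.Icc 1 N, (mon (2 * n) (dataVec na nb (path y ω) u k) γ -
          ∫ ω', mon (2 * n) (dataVec na nb (path y ω') u k) γ ∂P)) atTop (𝓝 0) := by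
      intro γ
      obtain ⟨ρ, q, hq0, hq1, hρ, hs⟩ := exists_covariance_mon_le hsys.input_bounded hcov γ
      exact strong_law_of_covariance_le (memLp_mon hL2 γ)
        (summable_variance_mon hsys.input_bounded hvar γ) hq0 hq1 hρ hs
    filter_upwards [ae_all_iff.2 hmon] with ω hω
    -- The coefficients of P_h do not depend on k, so the entry is a fixed finite combination of
    -- centred monomial averages.
    have hlim := tendsto_finsetSum (Finset.univ : Finset (Fin ((α.1 + β.1) (Sum.inl 0) + 1)))
      fun i _ => (hω ⟨Function.update (α.1 + β.1) (Sum.inl 0) (i : ℕ),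
        sum_update_le α β (Sum.inl 0) i⟩).const_mul
        ((debiasPoly (noiseMoment P ε) ((α.1 + β.1) (Sum.inl 0))).coeff i)
    simp only [mul_zero, Finset.sum_const_zero] at hlim
    refine hlim.congr fun N => ?_
    have hE : ∫ ω', avgProcMatrix na nb n (path y ω') (path ε ω') u N α β ∂P =
        (N : ℝ)⁻¹ * ∑ k ∈ Finset.Icc 1 N, Mproc na nb n (noiseMoment P ε)
          (fun γ => ∫ ω, mon (2 * n) (dataVec na nb (path y ω) u (k : ℤ)) γ ∂P) α β := by
      simp only [avgProcMatrix_apply]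
      rw [integral_const_mul, integral_finsetSum _ fun k hk =>
        (hmean k (Finset.mem_Icc.1 hk).1 α β).2.1]
      congr 1
      refine Finset.sum_congr rfl fun k hk => ?_
      obtain ⟨-, -, h1, h2⟩ := hmean k (Finset.mem_Icc.1 hk).1 α β
      exact h1.trans h2
    rw [Matrix.sub_apply, Matrix.of_apply, hE, empMatrix_apply, ← mul_sub,
      ← Finset.sum_sub_distrib]
    simp only [Mproc_apply, ← Finset.sum_sub_distrib, ← mul_sub]
    rw [Finset.sum_comm, Finset.mul_sum]
    refine Finset.sum_congr rfl fun i _ => ?_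
    rw [← Finset.mul_sum]
    ring
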